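/- \textbf{Setting.} Let $D$ be an oriented link diagram on $S^2$. Its \emph{segments} are the edges of the underlying $4$-valent graph (together with the crossingless components), and its \emph{regions} are the components of the complement. Draw each crossing so that both strands run from left to right: strand $1$ enters at the top left as segment $1$ and leaves at the bottom right as segment $1'$; strand $2$ enters at the bottom left as segment $2$ and leaves at the top right as segment $2'$. Strand $1$ is the over-strand at a positive crossing, strand $2$ at a negative one. The corners $N,W,S,E$ lie between $1$ and $2'$, $1$ and $2$, $2$ and $1'$, $1'$ and $2'$ respectively. A \emph{shape} is a triple $\chi=(a,b,m)$ of nonzero complex numbers. The partially defined braiding $B(\chi_1,\chi_2)=(\chi_{2'},\chi_{1'})$ is \[ a_{1'}=a_1A^{-1},\quad a_{2'}=a_2A,\quad A=1-\tfrac{m_1b_1}{b_2}\Bigl(1-\tfrac{a_1}{m_1}\Bigr)\Bigl(1-\tfrac1{m_2a_2}\Bigr), \] \[ b_{1'}=\tfrac{m_2b_2}{m_1}\Bigl(1-m_2a_2\Bigl(1-\tfrac{b_2}{m_1b_1}\Bigr)\Bigr)^{-1},\quad b_{2'}=b_1\Bigl(1-\tfrac{m_1}{a_1}\Bigl(1-\tfrac{b_2}{m_1b_1}\Bigr)\Bigr),\quad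 m_{1'}=m_1,\quad m_{2'}=m_2 . \] A \emph{shaping} of $D$ assigns a shape to each segment so that $B(\chi_1,\chi_2)=(\chi_{2'},\chi_{1'})$ at every positive crossing and $B(\chi_{2'},\chi_{1'})=(\chi_1,\chi_2)$, i.e. $B^{-1}(\chi_1,\chi_2)=(\chi_{2'},\chi_{1'})$, at every negative crossing. \textbf{The octahedral decomposition.} At each crossing place an ideal octahedron with an apex $P_i$ on each strand $i\in\{1,2\}$ and four equatorial ideal vertices, one in the direction of each of the segments $1,2,1',2'$. Those in the direction of the over-strand are pulled below the diagram, and those in the direction of the under-strand above it. It has eight vertical edges (apex to equatorial vertex) and four horizontal edges (between neighbouring equatorial vertices, one at each corner). Glue as follows: the two edges from the apex of one strand to the two equatorial vertices in the direction of the other strand are identified (the octahedron is \emph{twisted}); and along each side of each segment, the face of the octahedron at the start of the segment and the face of the octahedron at its end are glued, apex to apex, upper vertex to upper vertex, lower vertex to lower vertex. (The face at an end of a segment on a given side is spanned by the apex on that strand and the two equatorial vertices next to the corner on that side.) Given a shaping, the vertical edge from the apex of the strand of segment $j$ to the equatorial vertex in the direction of $j$ has the shape $o_j$, where \[ o_1=\tfrac{a_1}{m_1},\;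 o_2=\tfrac1{m_2a_2},\; o_{1'}=\tfrac{m_1}{a_{1'}},\; o_{2'}=m_2a_{2'}\quad\text{(positive crossing)}, \] \[ o_1=\tfrac1{m_1a_1},\; o_2=\tfrac{a_2}{m_2},\; o_{1'}=m_1a_{1'},\; o_{2'}=\tfrac{m_2}{a_{2'}}\quad\text{(negative crossing)}, \] and the horizontal edges have, at crossings of either sign, the shapes \[ o_N=\tfrac{b_{2'}}{b_1},\quad o_W=\tfrac{m_1b_1}{b_2},\quad o_S=\tfrac{m_2b_2}{m_1b_{1'}},\quad o_E=\tfrac{b_{1'}}{m_2b_{2'}} . \] The remaining four vertical edges have the shape that is forced by the condition that the shapes of the four edges at each equatorial vertex have product $1$: the edge from the apex of the other strand to the equatorial vertex in the direction of $j$ has shape $(o_j\,o_k\,o_l)^{-1}$, where $k,l$ are the two corners next to $j$. \textbf{Theorem.} For every shaping of $D$ the following hold. \begin{enumerate} \item At each of the six ideal vertices of every octahedron, the shapes of the four edges at that vertex have product $1$. \item (Gluing equations.) For every edge of the octahedral decomposition, vertical or horizontal, the product of the shapes of all octahedron edges that are glued together to it is $1$. \item (Region equations.) For every region of $D$, the product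 of the shapes of the horizontal edges at all corners of the region is $1$. \item ($m$-hyperbolicity equations.) For every segment with endpoints, with shape $(a,b,m)$, let $o$ be the shape $o_j$ of the vertical edge at its start and $o'$ the one at its end. Then $o/o'=m^2$ if the segment passes over at exactly one of its two ends, and $o\,o'=1$ if it passes over at both ends or under at both ends. \end{enumerate} -/

import Mathlib

/-! ### Oriented link diagrams on the sphere

Every crossing is read from left to right: the strand `one` enters at the top left (segment `1`)
and leaves at the bottom right (segment `1'`), the strand `two` enters at the bottom left
(segment `2`) and leaves at the top right (segment `2'`). The four regions at the crossing are
`N` (between `1` and `2'`), `W` (between `1` and `2`), `S` (between `2` and `1'`) and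
`E` (between `1'` and `2'`). -/

/-- The sign of a crossing of an oriented diagram. -/
inductive CrossingSign
  | pos
  | neg
  deriving DecidableEq

/-- The two strands through a crossing. -/
inductive Strand
  | one
  | two
  deriving DecidableEq

instance : Fintype Strand := ⟨{.one, .two}, fun x => by cases x <;> decide⟩

/-- The four segment ends at a crossing: `in1`, `in2`, `out1`, `out2` are the ends
labelled `1`, `2`, `1'`, `2'`. -/
inductive Slot
  | in1
  | in2
  | out1
  | out2
  deriving DecidableEq

instance : Fintype Slot := ⟨{.in1, .in2, .out1, .out2}, fun x => by cases x <;> decide⟩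

/-- The four corners at a crossing. -/
inductive Corner
  | N
  | W
  | S
  | E
  deriving DecidableEq

instance : Fintype Corner := ⟨{.N, .W, .S, .E}, fun x => by cases x <;> decide⟩

/-- The two sides of an oriented segment. -/
inductive Side
  | left
  | right
  deriving DecidableEq

instance : Fintype Side := ⟨{.left, .right}, fun x => by cases x <;> decide⟩

/-- The strand to which a segment end belongs. -/
def Slot.strand : Slot → Strand
  | .in1 => .one
  | .out1 => .one
  | .in2 => .two
  | .out2 => .two

/-- The end at which a strand enters the crossing. -/
def Strand.inSlot : Strand → Slot
  | .one => .in1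
  | .two => .in2

/-- The end at which a strand leaves the crossing. -/
def Strand.outSlot : Strand → Slot
  | .one => .out1
  | .two => .out2

/-- The other strand through the crossing. -/
def Strand.other : Strand → Strand
  | .one => .two
  | .two => .one

/-- The corner that lies on a given side (with respect to the orientation of the segment)
of a segment end. -/
def Slot.corner : Slot → Side → Corner
  | .in1, .left => .N
  | .in1, .right => .W
  | .in2, .left => .W
  | .in2, .right => .S
  | .out1, .left => .E
  | .out1, .right => .S
  | .out2, .left => .N
  | .out2, .right => .E

/-- The second segment end that bounds the corner `s.corner d`. -/
def Slot.across : Slot → Side → Slot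
  | .in1, .left => .out2
  | .in1, .right => .in2
  | .in2, .left => .in1
  | .in2, .right => .out1
  | .out1, .left => .out2
  | .out1, .right => .in2
  | .out2, .left => .in1
  | .out2, .right => .out1

/-- At a positive crossing the strand `one` passes over, at a negative one the strand `two`. -/
def CrossingSign.overStrand : CrossingSign → Strand
  | .pos => .one
  | .neg => .two

/-- The underlying oriented 4-valent graph with crossing signs. A segment with end points leaves
a crossing `c` along a strand `s`; it enters the crossing `(next (c, s)).1` as the strand
`(next (c, s)).2`. There may also be closed components without crossings. -/
structure DiagramGraph where
  Crossing : Type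
  Circle : Type
  [fintypeCrossing : Fintype Crossing]
  [fintypeCircle : Fintype Circle]
  sign : Crossing → CrossingSign
  next : (Crossing × Strand) ≃ (Crossing × Strand)

attribute [instance] DiagramGraph.fintypeCrossing DiagramGraph.fintypeCircle

namespace DiagramGraph

variable (G : DiagramGraph)

/-- The segments: a segment with end points is named by the crossing and the strand along which
it starts; the others are the components without crossings. -/
abbrev Segment : Type := (G.Crossing × Strand) ⊕ G.Circle

/-- The segment attached to a segment end at a crossing. -/
def segmentAt (c : G.Crossing) : Slot → G.Segment
  | .in1 => Sum.inl (G.next.symm (c, .one))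
  | .in2 => Sum.inl (G.next.symm (c, .two))
  | .out1 => Sum.inl (c, .one)
  | .out2 => Sum.inl (c, .two)

/-- Two sides of segments meet at a corner of the diagram. -/
def MeetAtCorner (x y : G.Segment × Side) : Prop :=
  ∃ (c : G.Crossing) (s t : Slot) (d e : Side),
    s.corner d = t.corner e ∧ x = (G.segmentAt c s, d) ∧ y = (G.segmentAt c t, e)

/-- The boundary curves of the regions: one walks along the sides of the segments
and turns at the corners. -/
abbrev BoundaryCurve : Type := Quot G.MeetAtCorner

end DiagramGraph

/-- An oriented link diagram on the sphere `S²`. Besides the graph, one records the region on each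
side of each segment (this is extra information only if the diagram is disconnected). Glueing to
the graph, for every region, a sphere with one hole for each boundary curve of that region gives
a closed oriented surface. It is required to be connected and of Euler characteristic `2`, where
that characteristic is `-#Crossing + ∑ r, (2 - #(boundary curves of r))`, as there are twice as
many segments with end points as crossings. -/
structure LinkDiagram extends DiagramGraph where
  Region : Type
  [fintypeRegion : Fintype Region]
  region : toDiagramGraph.Segment → Side → Region
  region_corner : ∀ (c : Crossing) (s t : Slot) (d e : Side), s.corner d = t.corner e →
    region (toDiagramGraph.segmentAt c s) d = region (toDiagramGraph.segmentAt c t) e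
  connected : ∀ r r' : Region,
    Relation.EqvGen (fun q q' => ∃ j, q = region j .left ∧ q' = region j .right) r r'
  euler : 2 * Fintype.card Region =
    Nat.card toDiagramGraph.BoundaryCurve + Fintype.card Crossing + 2

attribute [instance] LinkDiagram.fintypeRegion

/-! ### Shapes, the braiding, and shaped diagrams -/

/-- A shape is a triple of nonzero complex numbers. -/
structure Shape where
  a : ℂˣ
  b : ℂˣ
  m : ℂˣ

/-- The factor `A` of the braiding. -/
noncomputable def braidA (x₁ x₂ : Shape) : ℂ :=
  1 - (x₁.m * x₁.b / x₂.b) * (1 - x₁.a / x₁.m) * (1 - 1 / (x₂.m * x₂.a))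

/-- The denominator in the formula for `b` of the outgoing segment `1'`. -/
noncomputable def braidDen (x₁ x₂ : Shape) : ℂ :=
  1 - x₂.m * x₂.a * (1 - x₂.b / (x₁.m * x₁.b))

/-- `IsBraiding x₁ x₂ y₂ y₁` says that the partially defined braiding `B` is defined at `(x₁, x₂)`
and that `B (x₁, x₂) = (y₂, y₁)`; here `y₂` and `y₁` are the shapes of the segments `2'` and `1'`
of a positive crossing. -/
def IsBraiding (x₁ x₂ y₂ y₁ : Shape) : Prop :=
  braidA x₁ x₂ ≠ 0 ∧ braidDen x₁ x₂ ≠ 0 ∧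
  (y₁.a : ℂ) = x₁.a * (braidA x₁ x₂)⁻¹ ∧
  (y₂.a : ℂ) = x₂.a * braidA x₁ x₂ ∧
  (y₁.b : ℂ) = (x₂.m * x₂.b / x₁.m) * (braidDen x₁ x₂)⁻¹ ∧
  (y₂.b : ℂ) = x₁.b * (1 - (x₁.m / x₁.a) * (1 - x₂.b / (x₁.m * x₁.b))) ∧
  y₁.m = x₁.m ∧ y₂.m = x₂.m

namespace LinkDiagram

variable (D : LinkDiagram)

/-- An assignment of shapes to the segments is a shaping if `B (χ₁, χ₂) = (χ₂', χ₁')` at every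
positive crossing and `B⁻¹ (χ₁, χ₂) = (χ₂', χ₁')` at every negative crossing. -/
def IsShaping (χ : D.Segment → Shape) : Prop :=
  ∀ c : D.Crossing,
    match D.sign c with
    | .pos => IsBraiding (χ (D.segmentAt c .in1)) (χ (D.segmentAt c .in2))
        (χ (D.segmentAt c .out2)) (χ (D.segmentAt c .out1))
    | .neg => IsBraiding (χ (D.segmentAt c .out2)) (χ (D.segmentAt c .out1))
        (χ (D.segmentAt c .in1)) (χ (D.segmentAt c .in2))

end LinkDiagram

/-! ### The ideal octahedron at a crossing and the shapes of its edges

The octahedron has an apex `P₁` on the strand `one`, an apex `P₂` on the strand `two` (the apex on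
the over-strand is the upper one), and four equatorial ideal vertices, one in the direction of each
segment end. The equatorial vertices in the direction of the over-strand are pulled below the
diagram (they are `P₋` and `P₋'`), those in the direction of the under-strand are pulled above it
(they are `P₊` and `P₊'`). -/

/-- The twelve edges of the octahedron: `vert p s` joins the apex on the strand `p` to the
equatorial vertex at `s`, and `horiz k` joins the two equatorial vertices next to the
corner `k`. -/
inductive OctEdge
  | vert (p : Strand) (s : Slot)
  | horiz (k : Corner)
  deriving DecidableEq

/-- An edge is a vertical edge (a pair of a strand and a segment end) or a corner. -/
def octEdgeEquiv : ((Strand × Slot) ⊕ Corner) ≃ OctEdge where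
  toFun := Sum.elim (fun x => .vert x.1 x.2) .horiz
  invFun
    | .vert p s => Sum.inl (p, s)
    | .horiz k => Sum.inr k
  left_inv x := by rcases x with ⟨p, s⟩ | k <;> rfl
  right_inv e := by cases e <;> rfl

instance : Fintype OctEdge := Fintype.ofEquiv _ octEdgeEquiv

/-- The shape `o_j` of the vertical edge immediately below or above a segment end, at a crossing
whose segments have shapes `x`. -/
def segmentEdgeShape : CrossingSign → (Slot → Shape) → Slot → ℂˣ
  | .pos, x, .in1 => (x .in1).a / (x .in1).m
  | .pos, x, .in2 => 1 / ((x .in2).m * (x .in2).a)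
  | .pos, x, .out1 => (x .in1).m / (x .out1).a
  | .pos, x, .out2 => (x .in2).m * (x .out2).a
  | .neg, x, .in1 => 1 / ((x .in1).m * (x .in1).a)
  | .neg, x, .in2 => (x .in2).a / (x .in2).m
  | .neg, x, .out1 => (x .in1).m * (x .out1).a
  | .neg, x, .out2 => (x .in2).m / (x .out2).a

/-- The shape `o_k` of the horizontal edge near the region at the corner `k`. -/
def cornerEdgeShape (x : Slot → Shape) : Corner → ℂˣ
  | .N => (x .out2).b / (x .in1).b
  | .W => (x .in1).m * (x .in1).b / (x .in2).b
  | .S => (x .in2).m * (x .in2).b / ((x .in1).m * (x .out1).b)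
  | .E => (x .out1).b / ((x .in2).m * (x .out2).b)

/-- The shapes of all edges of the octahedron. The edge from the apex on a strand to an equatorial
vertex in the direction of that same strand has the shape `o_j`. The edge from the opposite apex to
that vertex has the shape that is forced by the fact that the shapes of the four edges at an ideal
vertex of an ideal octahedron have product `1`. -/
def octEdgeShape (ε : CrossingSign) (x : Slot → Shape) : OctEdge → ℂˣ
  | .horiz k => cornerEdgeShape x k
  | .vert p s =>
      if p = s.strand then segmentEdgeShape ε x s
      else (segmentEdgeShape ε x s * cornerEdgeShape x (s.corner .left) *
        cornerEdgeShape x (s.corner .right))⁻¹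

/-! ### The faces of the octahedra

The triangle `(s, d)`, for a segment end `s` and a side `d`, has as vertices the apex on the strand
of `s`, the equatorial vertex at `s`, and the equatorial vertex across the corner on the side `d`.
One of its two equatorial vertices lies above the diagram and the other one below. -/

/-- The edge of the face `(s, d)` from the apex to the vertex below the diagram. -/
def lowerFaceEdge (ε : CrossingSign) (s : Slot) (d : Side) : OctEdge :=
  .vert s.strand (if s.strand = ε.overStrand then s else s.across d)

/-- The edge of the face `(s, d)` from the apex to the vertex above the diagram. -/
def upperFaceEdge (ε : CrossingSign) (s : Slot) (d : Side) : OctEdge :=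
  .vert s.strand (if s.strand = ε.overStrand then s.across d else s)

/-- The edge of the face `(s, d)` from the vertex below to the vertex above the diagram. -/
def horizontalFaceEdge (s : Slot) (d : Side) : OctEdge :=
  .horiz (s.corner d)

namespace LinkDiagram

variable (D : LinkDiagram)

/-- The identifications of edges in the octahedral decomposition. First, each octahedron is
twisted: the two edges from the apex on one strand to the equatorial vertices in the direction of
the other strand are identified (`P₁P₊` with `P₁P₊'` and `P₂P₋` with `P₂P₋'` at a positive
crossing). Second, along each segment and on each of its two sides, the face at the start of the
segment is glued to the face at its end by the map that takes apex to apex, the lower vertex to the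
lower vertex and the upper vertex to the upper vertex. Thus horizontal edges are glued around regions,
upper vertical edges along over-arcs and lower vertical edges along under-arcs. -/
inductive Glued : D.Crossing × OctEdge → D.Crossing × OctEdge → Prop
  | twist (c : D.Crossing) (p : Strand) :
      Glued (c, .vert p p.other.inSlot) (c, .vert p p.other.outSlot)
  | lower (c : D.Crossing) (p : Strand) (d : Side) :
      Glued (c, lowerFaceEdge (D.sign c) p.outSlot d)
        ((D.next (c, p)).1,
          lowerFaceEdge (D.sign (D.next (c, p)).1) (D.next (c, p)).2.inSlot d)
  | upper (c : D.Crossing) (p : Strand) (d : Side) :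
      Glued (c, upperFaceEdge (D.sign c) p.outSlot d)
        ((D.next (c, p)).1,
          upperFaceEdge (D.sign (D.next (c, p)).1) (D.next (c, p)).2.inSlot d)
  | horizontal (c : D.Crossing) (p : Strand) (d : Side) :
      Glued (c, horizontalFaceEdge p.outSlot d)
        ((D.next (c, p)).1, horizontalFaceEdge (D.next (c, p)).2.inSlot d)

/-- An edge of the octahedral decomposition: a class of edges of octahedra under glueing. -/
abbrev GluedEdge : Type := Quot D.Glued

/-- The shape of an edge of the octahedron at a crossing of a diagram with shapes `χ`. -/
def edgeShape (χ : D.Segment → Shape) (c : D.Crossing) (e : OctEdge) : ℂˣ :=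
  octEdgeShape (D.sign c) (fun s => χ (D.segmentAt c s)) e

open Classical in
/-- The gluing equation of an edge `q` of the octahedral decomposition: the shapes of all octahedron
edges that are glued together to `q` have product `1`. -/
def GluingEquation (χ : D.Segment → Shape) (q : D.GluedEdge) : Prop :=
  ∏ x : D.Crossing × OctEdge with Quot.mk D.Glued x = q, D.edgeShape χ x.1 x.2 = 1

/-- The region that contains a corner. -/
def cornerRegion (c : D.Crossing) : Corner → D.Region
  | .N => D.region (D.segmentAt c .in1) .left
  | .W => D.region (D.segmentAt c .in2) .left
  | .S => D.region (D.segmentAt c .out1) .right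
  | .E => D.region (D.segmentAt c .out2) .right

open Classical in
/-- The region equation: the shapes of the horizontal edges at all corners of a region
have product `1`. -/
def RegionEquation (χ : D.Segment → Shape) (r : D.Region) : Prop :=
  ∏ x : D.Crossing × Corner with D.cornerRegion x.1 x.2 = r,
    D.edgeShape χ x.1 (.horiz x.2) = 1

/-- The vertices of the octahedron at every crossing: an apex on each strand and the four equatorial
vertices. Each of them is the end of four edges, whose shapes have product `1`. -/
def VertexEquations (χ : D.Segment → Shape) (c : D.Crossing) : Prop :=
  (∀ p : Strand, ∏ s : Slot, D.edgeShape χ c (.vert p s) = 1) ∧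
  (∀ s : Slot, (∏ p : Strand, D.edgeShape χ c (.vert p s)) *
    ∏ d : Side, D.edgeShape χ c (.horiz (s.corner d)) = 1)

/-- The strand `p` passes over at the crossing `c`. -/
def IsOver (c : D.Crossing) (p : Strand) : Prop := p = (D.sign c).overStrand

/-- The shape of the vertical edge at the start of the segment that leaves `c` along `p`. -/
def startShape (χ : D.Segment → Shape) (c : D.Crossing) (p : Strand) : ℂˣ :=
  D.edgeShape χ c (.vert p p.outSlot)

/-- The shape of the vertical edge at the end of the segment that leaves `c` along `p`. -/
def endShape (χ : D.Segment → Shape) (c : D.Crossing) (p : Strand) : ℂˣ :=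
  D.edgeShape χ (D.next (c, p)).1 (.vert (D.next (c, p)).2 (D.next (c, p)).2.inSlot)

/-- The `m`-hyperbolicity equation of the segment that leaves `c` along `p`: the shapes `o` and `o'`
of the vertical edges at its start and at its end satisfy `o / o' = m ^ 2` if it is over-under or
under-over, and `o * o' = 1` if it is over-over or under-under. -/
def MHyperbolicity (χ : D.Segment → Shape) (c : D.Crossing) (p : Strand) : Prop :=
  (¬ (D.IsOver c p ↔ D.IsOver (D.next (c, p)).1 (D.next (c, p)).2) →
    D.startShape χ c p / D.endShape χ c p = (χ (Sum.inl (c, p))).m ^ 2) ∧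
  ((D.IsOver c p ↔ D.IsOver (D.next (c, p)).1 (D.next (c, p)).2) →
    D.startShape χ c p * D.endShape χ c p = 1)

end LinkDiagram

/-! Two conservation laws of the braiding carry the vertex and gluing equations: each strand keeps
its `m`, and the product of the two `a` is preserved (`IsBalanced`).

The gluing equations are a telescoping argument. Fix a set of octahedron edges closed under gluing.
At one crossing the product of the shapes in this set is a quotient: the weights of the two outgoing
segment ends over those of the two incoming ones (`IsBalanced.prod_selectHom`). The weight of an end
depends only on the shape of its segment and on which edges of its faces lie in the set, and gluing
matches these at the start and the end of a segment. Over the whole diagram every segment therefore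
contributes its weight once above and once below (`IsShaping.prod_edgeShape`). A gluing class gives
a gluing equation; the horizontal edges at a region give its region equation. -/

theorem Strand.prod_univ {M : Type*} [CommMonoid M] (f : Strand → M) :
    ∏ p, f p = f .one * f .two := by
  have h : (Finset.univ : Finset Strand) = {.one, .two} := rfl
  simp [h]

theorem Side.prod_univ {M : Type*} [CommMonoid M] (f : Side → M) :
    ∏ d, f d = f .left * f .right := by
  have h : (Finset.univ : Finset Side) = {.left, .right} := rfl
  simp [h]

theorem Slot.prod_univ {M : Type*} [CommMonoid M] (f : Slot → M) :
    ∏ s, f s = f .in1 * f .in2 * f .out1 * f .out2 := by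
  have h : (Finset.univ : Finset Slot) = {.in1, .in2, .out1, .out2} := rfl
  simp [h, mul_assoc]

theorem Corner.prod_univ {M : Type*} [CommMonoid M] (f : Corner → M) :
    ∏ k, f k = f .N * f .W * f .S * f .E := by
  have h : (Finset.univ : Finset Corner) = {.N, .W, .S, .E} := rfl
  simp [h, mul_assoc]

theorem OctEdge.prod_univ {M : Type*} [CommMonoid M] (f : OctEdge → M) :
    ∏ e, f e = (∏ p, ∏ s, f (.vert p s)) * ∏ k, f (.horiz k) := by
  rw [← octEdgeEquiv.prod_comp, Fintype.prod_sum_type, Fintype.prod_prod_type]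
  rfl

/-! ### Relations between shapes at a single crossing -/

/-- The relations between the shapes at a crossing from which the gluing equations follow. -/
structure IsBalanced (x : Slot → Shape) : Prop where
  m_one : (x .out1).m = (x .in1).m
  m_two : (x .out2).m = (x .in2).m
  a_mul : (x .out1).a * (x .out2).a = (x .in1).a * (x .in2).a

/-- The factor `braidA` multiplies one `a` and divides the other. -/
theorem IsBraiding.a_mul {x₁ x₂ y₂ y₁ : Shape} (h : IsBraiding x₁ x₂ y₂ y₁) :
    y₁.a * y₂.a = x₁.a * x₂.a := by
  obtain ⟨hA, -, h₁, h₂, -⟩ := h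
  ext
  push_cast
  rw [h₁, h₂]
  field_simp

/-- A negative crossing exchanges the incoming and outgoing pairs of the braiding, and the
conservation laws are symmetric under this exchange. -/
theorem LinkDiagram.IsShaping.isBalanced {D : LinkDiagram} {χ : D.Segment → Shape}
    (hχ : D.IsShaping χ) (c : D.Crossing) : IsBalanced fun s => χ (D.segmentAt c s) := by
  have h := hχ c
  split at h
  · exact ⟨h.2.2.2.2.2.2.1, h.2.2.2.2.2.2.2, h.a_mul⟩
  · refine ⟨h.2.2.2.2.2.2.2.symm, h.2.2.2.2.2.2.1.symm, ?_⟩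
    rw [mul_comm, ← h.a_mul, mul_comm]

theorem cornerEdgeShape_prod (x : Slot → Shape) :
    cornerEdgeShape x .N * cornerEdgeShape x .W * cornerEdgeShape x .S * cornerEdgeShape x .E
      = 1 := by
  ext
  simp only [cornerEdgeShape]
  push_cast
  field_simp

/-- The product of the two edges at the apex on `p` that are identified by the twist. -/
theorem octEdgeShape_twist_mul (ε : CrossingSign) (x : Slot → Shape) (p : Strand) :
    octEdgeShape ε x (.vert p p.other.inSlot) * octEdgeShape ε x (.vert p p.other.outSlot) =
      (segmentEdgeShape ε x p.other.inSlot * segmentEdgeShape ε x p.other.outSlot)⁻¹ := by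
  have h := cornerEdgeShape_prod x
  -- Two opposite equatorial vertices touch each of the four corners once. Writing `1` as the
  -- product of the corner shapes leaves a formal identity of monomials.
  rw [← mul_inv_eq_one, inv_inv, ← inv_eq_one, ← h]
  cases p <;>
  · simp only [octEdgeShape, Strand.other, Strand.inSlot, Strand.outSlot, Slot.strand,
      Slot.corner, reduceCtorEq, if_false]
    ext
    push_cast
    field_simp

/-- The `m` cancel along each strand, leaving inverse ratios of incoming and outgoing `a` on the two
strands; they agree by conservation of the product. -/
theorem IsBalanced.segmentEdgeShape_mul {x : Slot → Shape} (h : IsBalanced x)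
    (ε : CrossingSign) :
    segmentEdgeShape ε x .in1 * segmentEdgeShape ε x .out1 =
      segmentEdgeShape ε x .in2 * segmentEdgeShape ε x .out2 := by
  have ha := congrArg Units.val h.a_mul
  push_cast at ha
  cases ε
  · ext
    simp only [segmentEdgeShape]
    push_cast
    field_simp
    exact ha.symm
  · ext
    simp only [segmentEdgeShape]
    push_cast
    field_simp
    exact ha

theorem IsBalanced.octEdgeShape_apex {x : Slot → Shape} (h : IsBalanced x) (ε : CrossingSign)
    (p : Strand) : ∏ s, octEdgeShape ε x (.vert p s) = 1 := by
  have hs := h.segmentEdgeShape_mul ε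
  have ht := octEdgeShape_twist_mul ε x p
  rw [Slot.prod_univ]
  cases p
  · simp only [Strand.other, Strand.inSlot, Strand.outSlot] at ht
    calc _ = (octEdgeShape ε x (.vert .one .in1) * octEdgeShape ε x (.vert .one .out1)) *
          (octEdgeShape ε x (.vert .one .in2) * octEdgeShape ε x (.vert .one .out2)) := by
            ac_rfl
      _ = 1 := by
        rw [ht, ← hs]
        exact mul_inv_cancel _
  · simp only [Strand.other, Strand.inSlot, Strand.outSlot] at ht
    calc _ = (octEdgeShape ε x (.vert .two .in2) * octEdgeShape ε x (.vert .two .out2)) *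
          (octEdgeShape ε x (.vert .two .in1) * octEdgeShape ε x (.vert .two .out1)) := by
            ac_rfl
      _ = 1 := by
        rw [ht, hs]
        exact mul_inv_cancel _

theorem octEdgeShape_equator (ε : CrossingSign) (x : Slot → Shape) (s : Slot) :
    (∏ p, octEdgeShape ε x (.vert p s)) * ∏ d, octEdgeShape ε x (.horiz (s.corner d)) = 1 := by
  rw [Strand.prod_univ, Side.prod_univ]
  cases s <;>
  · simp only [octEdgeShape, Slot.strand, reduceCtorEq, if_false, if_true]
    ext
    push_cast
    field_simp

/-! ### Products at a crossing as quotients of face weights -/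

open Classical in
/-- The identity if `P` holds, the trivial homomorphism otherwise. -/
noncomputable def selectHom (P : Prop) : ℂˣ →* ℂˣ := if P then MonoidHom.id _ else 1

open Classical in
theorem selectHom_apply (P : Prop) (u : ℂˣ) : selectHom P u = if P then u else 1 := by
  unfold selectHom
  split <;> rfl

/-- The contribution of the segment end `s` with shape `y` to the product of the shapes of the
edges that satisfy `P`; it is counted positively at the start of a segment and negatively at
its end. -/
noncomputable def faceWeight (P : OctEdge → Prop) (ε : CrossingSign) (s : Slot) (y : Shape) : ℂˣ :=
  selectHom (P (horizontalFaceEdge s .left)) y.b *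
  selectHom (P (horizontalFaceEdge s .right)) (y.m * y.b)⁻¹ *
  selectHom (P (upperFaceEdge ε s .left)) (y.m * y.a) *
  selectHom (P (lowerFaceEdge ε s .left)) (y.m / y.a)

/-- Each corner shape is already a quotient of weights of its two bounding ends. For vertical edges
the left side suffices: at an end, one vertical face edge is the strand's own edge, common to both
sides, and the other belongs to the twisted pair, on whose members `P` agrees by `hP`. -/
theorem IsBalanced.prod_selectHom {x : Slot → Shape} (h : IsBalanced x) (ε : CrossingSign)
    (P : OctEdge → Prop)
    (hP : ∀ p : Strand, P (.vert p p.other.inSlot) ↔ P (.vert p p.other.outSlot)) :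
    ∏ e, selectHom (P e) (octEdgeShape ε x e) =
      (∏ p : Strand, faceWeight P ε p.outSlot (x p.outSlot)) *
        (∏ p : Strand, faceWeight P ε p.inSlot (x p.inSlot))⁻¹ := by
  have h₁ := octEdgeShape_twist_mul ε x .one
  have h₂ := octEdgeShape_twist_mul ε x .two
  have hs := h.segmentEdgeShape_mul ε
  simp only [Strand.other, Strand.inSlot, Strand.outSlot] at h₁ h₂
  have hP₁ := propext (hP .one)
  have hP₂ := propext (hP .two)
  simp only [Strand.other, Strand.inSlot, Strand.outSlot] at hP₁ hP₂
  -- Express the shape of each twisted pair by the strand of its own apex, so that it splits into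
  -- weights of that strand's two ends.
  rw [← hs] at h₁
  rw [hs] at h₂
  have k₁ := congrArg (selectHom (P (.vert .one .in2))) h₁
  have k₂ := congrArg (selectHom (P (.vert .two .in1))) h₂
  rw [map_mul] at k₁ k₂
  have hv : ∏ p, ∏ s, selectHom (P (.vert p s)) (octEdgeShape ε x (.vert p s)) =
      selectHom (P (.vert .one .in1)) (segmentEdgeShape ε x .in1) *
      selectHom (P (.vert .one .out1)) (segmentEdgeShape ε x .out1) *
      selectHom (P (.vert .two .in2)) (segmentEdgeShape ε x .in2) *
      selectHom (P (.vert .two .out2)) (segmentEdgeShape ε x .out2) *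
      selectHom (P (.vert .one .in2))
        (segmentEdgeShape ε x .in1 * segmentEdgeShape ε x .out1)⁻¹ *
      selectHom (P (.vert .two .in1))
        (segmentEdgeShape ε x .in2 * segmentEdgeShape ε x .out2)⁻¹ := by
    rw [← k₁, ← k₂, Strand.prod_univ, Slot.prod_univ, Slot.prod_univ, ← hP₁, ← hP₂]
    have e₁ : segmentEdgeShape ε x .in1 = octEdgeShape ε x (.vert .one .in1) := rfl
    have e₂ : segmentEdgeShape ε x .in2 = octEdgeShape ε x (.vert .two .in2) := rfl
    have e₃ : segmentEdgeShape ε x .out1 = octEdgeShape ε x (.vert .one .out1) := rfl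
    have e₄ : segmentEdgeShape ε x .out2 = octEdgeShape ε x (.vert .two .out2) := rfl
    rw [e₁, e₂, e₃, e₄]
    ac_rfl
  rw [OctEdge.prod_univ, hv, Corner.prod_univ, Strand.prod_univ, Strand.prod_univ]
  cases ε <;>
  · simp only [faceWeight, octEdgeShape, cornerEdgeShape, segmentEdgeShape, horizontalFaceEdge,
      upperFaceEdge, lowerFaceEdge, Slot.corner, Slot.across, Slot.strand, Strand.inSlot,
      Strand.outSlot, CrossingSign.overStrand, reduceCtorEq, if_true, if_false, h.m_one, h.m_two,
      ← hP₁, map_mul, map_div, map_inv, map_one]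
    ext
    push_cast
    field_simp

/-! ### Telescoping along segments: gluing and region equations -/

namespace LinkDiagram

variable {D : LinkDiagram} {χ : D.Segment → Shape}

theorem segmentAt_outSlot (c : D.Crossing) (p : Strand) :
    D.segmentAt c p.outSlot = Sum.inl (c, p) := by
  cases p <;> rfl

theorem segmentAt_next_inSlot (y : D.Crossing × Strand) :
    D.segmentAt (D.next y).1 (D.next y).2.inSlot = Sum.inl y := by
  have h : ∀ z : D.Crossing × Strand, D.segmentAt z.1 z.2.inSlot = Sum.inl (D.next.symm z) := by
    rintro ⟨c, _ | _⟩ <;> rfl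
  rw [h, Equiv.symm_apply_apply]

theorem cornerRegion_corner (c : D.Crossing) (s : Slot) (d : Side) :
    D.cornerRegion c (s.corner d) = D.region (D.segmentAt c s) d := by
  cases s <;> cases d <;> exact D.region_corner _ _ _ _ _ rfl

open Classical in
/-- The shapes of the edges in a set that is closed under glueing have product `1`. -/
theorem IsShaping.prod_edgeShape (hχ : D.IsShaping χ) (P : D.Crossing × OctEdge → Prop)
    (hP : ∀ x y, D.Glued x y → (P x ↔ P y)) :
    ∏ x : D.Crossing × OctEdge with P x, D.edgeShape χ x.1 x.2 = 1 := by
  let w (y : D.Crossing × Strand) (s : Slot) : ℂˣ :=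
    faceWeight (fun e => P (y.1, e)) (D.sign y.1) s (χ (D.segmentAt y.1 s))
  have key (c : D.Crossing) : ∏ e, (if P (c, e) then D.edgeShape χ c e else 1) =
      (∏ p : Strand, w (c, p) p.outSlot) * (∏ p : Strand, w (c, p) p.inSlot)⁻¹ := by
    rw [← (hχ.isBalanced c).prod_selectHom (D.sign c) (fun e => P (c, e))
      fun p => hP _ _ (.twist c p)]
    simp only [selectHom_apply, edgeShape]
  have hnext (y : D.Crossing × Strand) :
      w y y.2.outSlot = w (D.next y) (D.next y).2.inSlot := by
    obtain ⟨c, p⟩ := y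
    have hseg := (segmentAt_outSlot (D := D) c p).trans (segmentAt_next_inSlot (c, p)).symm
    simp only [w, faceWeight, hseg]
    rw [propext (hP _ _ (.horizontal c p .left)), propext (hP _ _ (.horizontal c p .right)),
      propext (hP _ _ (.upper c p .left)), propext (hP _ _ (.lower c p .left))]
  -- Reindexing the incoming ends by `next` pairs the two ends of each segment.
  rw [Finset.prod_filter, Fintype.prod_prod_type, Finset.prod_congr rfl fun c _ => key c,
    Finset.prod_mul_distrib, Finset.prod_inv_distrib,
    ← Fintype.prod_prod_type' (fun c p => w (c, p) p.outSlot),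
    ← Fintype.prod_prod_type' (fun c p => w (c, p) p.inSlot),
    ← D.next.prod_comp (fun y => w (y.1, y.2) y.2.inSlot), mul_inv_eq_one]
  exact Finset.prod_congr rfl fun y _ => hnext y

theorem IsShaping.vertexEquations (hχ : D.IsShaping χ) (c : D.Crossing) :
    D.VertexEquations χ c :=
  ⟨(hχ.isBalanced c).octEdgeShape_apex _, octEdgeShape_equator _ _⟩

theorem IsShaping.gluingEquation (hχ : D.IsShaping χ) (q : D.GluedEdge) :
    D.GluingEquation χ q :=
  hχ.prod_edgeShape (fun x => Quot.mk D.Glued x = q) fun _ _ h => by rw [Quot.sound h]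

theorem IsShaping.regionEquation (hχ : D.IsShaping χ) (r : D.Region) :
    D.RegionEquation χ r := by
  classical
  -- A region may have several boundary curves, so this set can be a union of several gluing
  -- classes.
  let P : D.Crossing × OctEdge → Prop
    | (_, .vert _ _) => False
    | (c, .horiz k) => D.cornerRegion c k = r
  have h := hχ.prod_edgeShape P fun x y hxy => by
    cases hxy with
    | twist | lower | upper => exact Iff.rfl
    | horizontal c p d =>
      change D.cornerRegion _ _ = r ↔ D.cornerRegion _ _ = r
      rw [cornerRegion_corner, cornerRegion_corner, segmentAt_outSlot, segmentAt_next_inSlot]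
  rw [Finset.prod_filter, Fintype.prod_prod_type] at h
  unfold RegionEquation
  rw [Finset.prod_filter, Fintype.prod_prod_type]
  refine Eq.trans ?_ h
  refine Finset.prod_congr rfl fun c _ => ?_
  simp [OctEdge.prod_univ, P]

/-! ### The `m`-hyperbolicity equations -/

/-- At an outgoing end `segmentEdgeShape` uses the `m` of the incoming segment; conservation of `m`
turns it into that of the departing one. -/
theorem IsShaping.startShape_eq (hχ : D.IsShaping χ) (c : D.Crossing) (p : Strand) :
    (D.IsOver c p → D.startShape χ c p = (χ (Sum.inl (c, p))).m / (χ (Sum.inl (c, p))).a) ∧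
    (¬ D.IsOver c p → D.startShape χ c p = (χ (Sum.inl (c, p))).m * (χ (Sum.inl (c, p))).a) := by
  have h₁ := (hχ.isBalanced c).m_one
  have h₂ := (hχ.isBalanced c).m_two
  rcases hc : D.sign c <;> cases p <;>
    simp_all [IsOver, startShape, edgeShape, octEdgeShape, Strand.outSlot, Slot.strand,
      segmentEdgeShape, CrossingSign.overStrand, DiagramGraph.segmentAt]

theorem edgeShape_inSlot (χ : D.Segment → Shape) (c : D.Crossing) (p : Strand) :
    (D.IsOver c p → D.edgeShape χ c (.vert p p.inSlot) =
      (χ (D.segmentAt c p.inSlot)).a / (χ (D.segmentAt c p.inSlot)).m) ∧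
    (¬ D.IsOver c p → D.edgeShape χ c (.vert p p.inSlot) =
      1 / ((χ (D.segmentAt c p.inSlot)).m * (χ (D.segmentAt c p.inSlot)).a)) := by
  rcases hc : D.sign c <;> cases p <;>
    simp [IsOver, hc, edgeShape, octEdgeShape, Strand.inSlot, Slot.strand,
      segmentEdgeShape, CrossingSign.overStrand]

/-- The start shape is `m / a` over and `m * a` under, and the end shape is the inverse of the same
expression, so equal types cancel and mixed types leave `m ^ 2`. -/
theorem IsShaping.mHyperbolicity (hχ : D.IsShaping χ) (c : D.Crossing) (p : Strand) :
    D.MHyperbolicity χ c p := by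
  obtain ⟨s₁, s₂⟩ := hχ.startShape_eq c p
  have e := edgeShape_inSlot χ (D.next (c, p)).1 (D.next (c, p)).2
  rw [segmentAt_next_inSlot] at e
  obtain ⟨e₁, e₂⟩ := e
  unfold MHyperbolicity endShape
  by_cases h : D.IsOver c p <;> by_cases h' : D.IsOver (D.next (c, p)).1 (D.next (c, p)).2
  · simp [h, h', s₁ h, e₁ h']
  · simp only [h, h', s₁ h, e₂ h']
    refine ⟨fun _ => ?_, fun k => absurd k (by simp)⟩
    ext
    push_cast
    field_simp
  · simp only [h, h', s₂ h, e₁ h']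
    refine ⟨fun _ => ?_, fun k => absurd k (by simp)⟩
    ext
    push_cast
    field_simp
  · simp [h, h', s₂ h, e₂ h']

end LinkDiagram

theorem mainTheorem2 (D : LinkDiagram) (χ : D.Segment → Shape) (hχ : D.IsShaping χ) :
    (∀ c : D.Crossing, D.VertexEquations χ c) ∧
    (∀ q : D.GluedEdge, D.GluingEquation χ q) ∧
    (∀ r : D.Region, D.RegionEquation χ r) ∧
    (∀ (c : D.Crossing) (p : Strand), D.MHyperbolicity χ c p) :=
  ⟨hχ.vertexEquations, hχ.gluingEquation, hχ.regionEquation, hχ.mHyperbolicity⟩
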